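/- Let $\mathcal X$ be a measurable space with a $\sigma$-finite base measure, written $dx$ (e.g. Lebesgue or counting measure), and let $\phi:\mathcal X^2\to\mathbb R$ be a measurable Mercer kernel (every matrix $(\phi(x^{(i)},x^{(j)}))_{i,j}$ is symmetric positive semidefinite) with $\int_{\mathcal X}\exp(-c\,\phi(x,x))\,dx<\infty$ for every $c>0$. Put $f(x)=-\phi(x,x)$, let $p\ge 1$, and for $\theta=(\theta_{st})_{1\le s<t\le p}\in\mathbb R^{p(p-1)/2}$ consider the density on $\mathcal X^p$ $$\mathbb P(x;\theta)=\exp\Big\{\sum_{s=1}^p f(x_s)+\sum_{s<t}\theta_{st}\,\phi(x_s,x_t)-A(\theta)\Big\},\qquad A(\theta)=\log\int_{\mathcal X^p}\exp\Big\{\sum_s f(x_s)+\sum_{s<t}\theta_{st}\phi(x_s,x_t)\Big\}dx .$$ Let $\theta^*$ be a parameter vector with $|\theta^*_{st}|\le 0.25$ for all $s<t$, such that the model has minimal representation: no other parameter vector $\theta$ with $A(\theta)<\infty$ gives the same distribution as $\theta^*$. If the graph $\{(s,t):\theta^*_{st}\neq 0\}$ has a vertex of degree at least $8$, assume also that $A$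 is finite in a neighbourhood of $\theta^*$ (so that the gradient of the likelihood at $\theta^*$ exists; when all degrees are at most $7$ this follows from the other assumptions). For an i.i.d. sample $\mathbb X_n=(X^{(1)},\dots,X^{(n)})$ from $\mathbb P(\cdot\,;\theta^*)$ let $L(\theta;\mathbb X_n)=-\frac1n\sum_{i=1}^n\log\mathbb P(X^{(i)};\theta)$ (with $L=+\infty$ where $A(\theta)=+\infty$), let $\gamma_n=\|\nabla L(\theta^*;\mathbb X_n)\|_\infty$ be the largest absolute value of a partial derivative $\partial L/\partial\theta_{st}$ at $\theta^*$ ($\gamma_n=0$ if $p=1$), and let $$\hat\theta_n=\arg\min_\theta\{L(\theta;\mathbb X_n)+\lambda_n\|\theta\|_1\}.$$ Then there are constants $\sigma,\zeta,r,\beta>0$, which do not depend on $n$, such that for every $c_0\ge 2$ and every $$n>\max\Big(\frac{6\ln p}{\sigma^2\zeta^2},\;13.5\,c_0^2r^{-2}\beta^{-2}\sigma^2\|\theta^*\|_0\ln p\Big)$$ the following holds with probability at least $1-2p^{-1}$: for every $\lambda_n\in[2\gamma_n,c_0\gamma_n]$ the minimizer $\hat\theta_n$ exists, is unique, and satisfies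 $$\|\hat\theta_n-\theta^*\|\le 1.5\,c_0\,\beta^{-1}\sigma\sqrt{6\,\|\theta^*\|_0\ln p/n}.$$ Here $\|\theta\|$ is the Euclidean norm, $\|\theta\|_1=\sum_{s<t}|\theta_{st}|$, and $\|\theta\|_0$ is the number of nonzero entries of $\theta$. -/

import Mathlib

open MeasureTheory ProbabilityTheory

universe u w

namespace SemiEFGM

/-- The unordered pairs of distinct vertices of `{1, …, p}`, written with the smaller one first. -/
abbrev Pairs (p : ℕ) : Type := {e : Fin p × Fin p // e.1 < e.2}

/-- The pairwise parameters `θ = (θ_st)` of the model, with the Euclidean norm. -/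
abbrev Param (p : ℕ) : Type := EuclideanSpace ℝ (Pairs p)

/-- The number of nonzero entries of `θ`. -/
noncomputable def l0 {p : ℕ} (θ : Param p) : ℕ := (Finset.univ.filter fun e => θ e ≠ 0).card

/-- The sum of the absolute values of the entries of `θ`. -/
noncomputable def l1 {p : ℕ} (θ : Param p) : ℝ := ∑ e, |θ e|

/-- The degree of the vertex `s` in the graph whose edges are the pairs with `θ_st ≠ 0`. -/
noncomputable def degree {p : ℕ} (θ : Param p) (s : Fin p) : ℕ :=
  (Finset.univ.filter fun e : Pairs p => θ e ≠ 0 ∧ (e.1.1 = s ∨ e.1.2 = s)).card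

/-- Mercer kernels: all the matrices `φ (x i) (x j)` are (symmetric) positive semidefinite. -/
def IsMercerKernel {𝒳 : Type*} (φ : 𝒳 → 𝒳 → ℝ) : Prop :=
  ∀ (m : ℕ) (x : Fin m → 𝒳), (Matrix.of fun i j => φ (x i) (x j)).PosSemidef

section Model

variable {𝒳 : Type*} {p : ℕ}

/-- The exponent `∑_s f(x_s) + ∑_{s<t} θ_st φ(x_s, x_t)` of the density. -/
noncomputable def energy (f : 𝒳 → ℝ) (φ : 𝒳 → 𝒳 → ℝ) (θ : Param p) (x : Fin p → 𝒳) : ℝ :=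
  ∑ s, f (x s) + ∑ e : Pairs p, θ e * φ (x e.1.1) (x e.1.2)

variable [MeasurableSpace 𝒳] (ν : Measure 𝒳) (f : 𝒳 → ℝ) (φ : 𝒳 → 𝒳 → ℝ)

/-- The parameters `θ` at which the log-partition function is finite, `A(θ) < ∞`. -/
def domain : Set (Param p) :=
  {θ | Integrable (fun x => Real.exp (energy f φ θ x)) (Measure.pi fun _ : Fin p => ν)}

/-- The log-partition function `A(θ)`; meaningful for `θ` in `domain`. -/
noncomputable def logPartition (θ : Param p) : ℝ :=
  Real.log (∫ x, Real.exp (energy f φ θ x) ∂(Measure.pi fun _ : Fin p => ν))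

/-- The density of the model with respect to the product base measure. -/
noncomputable def density (θ : Param p) (x : Fin p → 𝒳) : ℝ :=
  Real.exp (energy f φ θ x - logPartition ν f φ θ)

/-- The distribution of the model with parameter `θ`. -/
noncomputable def law (θ : Param p) : Measure (Fin p → 𝒳) :=
  (Measure.pi fun _ : Fin p => ν).withDensity fun x => ENNReal.ofReal (density ν f φ θ x)

/-- The distribution with parameter `θ` has minimal representation: `θ` is the only parameter
vector that gives this distribution. -/
def MinimalRepresentation (θ : Param p) : Prop :=
  ∀ θ' ∈ domain ν f φ, law ν f φ θ' = law ν f φ θ → θ' = θ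

/-- The normalized negative log-likelihood `L(θ; x)` of the sample `x 1, …, x n`. -/
noncomputable def negLogLik {n : ℕ} (x : Fin n → Fin p → 𝒳) (θ : Param p) : ℝ :=
  -(1 / (n : ℝ)) * ∑ i, Real.log (density ν f φ θ (x i))

/-- The sup-norm `‖∇L(θ; x)‖_∞` of the vector of the partial derivatives `∂L/∂θ_st`. -/
noncomputable def gradSupNorm {n : ℕ} (x : Fin n → Fin p → 𝒳) (θ : Param p) : ℝ :=
  ⨆ e : Pairs p, |lineDeriv ℝ (negLogLik ν f φ x) θ (EuclideanSpace.single e 1)|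

/-- `θ` is a global minimizer of `L(·; x) + lam ‖·‖₁`, where `L = +∞` outside `domain`. -/
def IsJointEstimator {n : ℕ} (x : Fin n → Fin p → 𝒳) (lam : ℝ) (θ : Param p) : Prop :=
  θ ∈ domain ν f φ ∧ ∀ θ' ∈ domain ν f φ,
    negLogLik ν f φ x θ + lam * l1 θ ≤ negLogLik ν f φ x θ' + lam * l1 θ'

end Model

end SemiEFGM

namespace SemiEFGM

/-! The constants may depend on everything but `n`, in particular on `p`, so convexity, compactness
and Chebyshev's inequality suffice.

Up to an affine term, `L` is the log-Laplace transform of the statistics `φ(x_s, x_t)` under the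
true law. By minimality no nonzero combination of them is a.s. constant, so `L` is strictly convex
and, near `θ*`, exceeds its linearization by at least `β‖Δ‖²`, where `Δ = θ - θ*`
(`exists_quadratic_growth_log_integral_exp`). If `λ ≥ 2γ`, the linear part and the penalty together
decrease by at most `1.5 λ √‖θ*‖₀ ‖Δ‖` (`penalty_lower_bound`). Hence a minimizer over a small ball
satisfies `β‖Δ‖ ≤ 1.5 λ √‖θ*‖₀`; for large `n` this places it inside the ball, and by strict
convexity it is then the unique global minimizer (`l1_penalized_minimizer`).

The gradient at `θ*` is a mean minus a sample mean, with finite variance because `θ*` is interior to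
the domain. Chebyshev and a union bound control `γ`; the factor `p` lost there is absorbed into `σ`.
-/

/-! ### Deterministic analysis of `ℓ¹`-penalized convex functions. -/

lemma sum_abs_support_le {ι : Type*} [Fintype ι] (θ Δ : EuclideanSpace ℝ ι) :
    ∑ e with θ e ≠ 0, |Δ e| ≤ √((Finset.univ.filter fun e => θ e ≠ 0).card : ℝ) * ‖Δ‖ := by
  rw [EuclideanSpace.norm_eq, ← Real.sqrt_mul (by positivity)]
  refine Real.le_sqrt_of_sq_le (sq_sum_le_card_mul_sum_sq.trans ?_)
  gcongr
  · simp only [sq_abs, Real.norm_eq_abs]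
    exact Finset.sum_le_sum_of_subset_of_nonneg (Finset.filter_subset _ _)
      fun _ _ _ => sq_nonneg _

/-- Coordinatewise: off the support of `θ₀` the penalty gains `lam * |θ e|`, which beats the linear
term; on the support at most `(γ + lam) * |θ e - θ₀ e|` is lost, and `γ + lam ≤ 1.5 * lam`.
Cauchy–Schwarz on the support finishes. -/
lemma penalty_lower_bound {ι : Type*} [Fintype ι] (θ₀ θ : EuclideanSpace ℝ ι) (g : ι → ℝ)
    {γ lam : ℝ} (hg : ∀ e, |g e| ≤ γ) (hlam : 2 * γ ≤ lam) (hlam0 : 0 ≤ lam) :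
    -(1.5 * lam * (√((Finset.univ.filter fun e => θ₀ e ≠ 0).card : ℝ) * ‖θ - θ₀‖)) ≤
      ∑ e, g e * (θ e - θ₀ e) + lam * (∑ e, |θ e| - ∑ e, |θ₀ e|) := by
  have h1 := sum_abs_support_le θ₀ (θ - θ₀)
  have h2 : -(1.5 * lam * ∑ e with θ₀ e ≠ 0, |(θ - θ₀) e|) ≤
      ∑ e, g e * (θ e - θ₀ e) + lam * (∑ e, |θ e| - ∑ e, |θ₀ e|) := by
    rw [Finset.sum_filter, Finset.mul_sum, ← Finset.sum_neg_distrib, ← Finset.sum_sub_distrib,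
      Finset.mul_sum, ← Finset.sum_add_distrib]
    refine Finset.sum_le_sum fun e _ => ?_
    have hge : -(γ * |θ e - θ₀ e|) ≤ g e * (θ e - θ₀ e) := by
      refine (neg_le_neg ?_).trans (neg_abs_le _)
      rw [abs_mul]
      exact mul_le_mul_of_nonneg_right (hg e) (abs_nonneg _)
    have hnn := abs_nonneg (θ e - θ₀ e)
    by_cases h0 : θ₀ e = 0
    · simp only [h0, ne_eq, not_true_eq_false, if_false, mul_zero, neg_zero, sub_zero, abs_zero]
        at hge hnn ⊢
      nlinarith
    · have hti : |θ₀ e| - |θ e| ≤ |θ e - θ₀ e| := by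
        rw [abs_sub_comm]; exact abs_sub_abs_le_abs_sub _ _
      simp only [ne_eq, h0, not_false_eq_true, if_true, PiLp.sub_apply]
      nlinarith
  have h3 : 1.5 * lam * ∑ e with θ₀ e ≠ 0, |(θ - θ₀) e| ≤
      1.5 * lam * (√((Finset.univ.filter fun e => θ₀ e ≠ 0).card : ℝ) * ‖θ - θ₀‖) := by
    gcongr
  linarith

/-- Existence, uniqueness and `ℓ²`-error of the minimizer of an `ℓ¹`-penalized strictly convex
function which grows quadratically around `θ₀`, after subtraction of its linear part `g`. -/
theorem l1_penalized_minimizer {ι : Type*} [Fintype ι] {D : Set (EuclideanSpace ℝ ι)}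
    {L : EuclideanSpace ℝ ι → ℝ} (hL : StrictConvexOn ℝ D L) {θ₀ : EuclideanSpace ℝ ι}
    {r β γ lam : ℝ} (hr : 0 < r) (hβ : 0 < β) (hball : Metric.closedBall θ₀ r ⊆ D)
    (hcont : ContinuousOn L (Metric.closedBall θ₀ r)) (g : ι → ℝ) (hg : ∀ e, |g e| ≤ γ)
    (hgrow : ∀ θ ∈ Metric.closedBall θ₀ r,
      β * ‖θ - θ₀‖ ^ 2 ≤ L θ - L θ₀ - ∑ e, g e * (θ e - θ₀ e))
    (hlam : 2 * γ ≤ lam) (hlam0 : 0 ≤ lam)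
    (hrad : 1.5 * lam * √((Finset.univ.filter fun e => θ₀ e ≠ 0).card : ℝ) / β < r) :
    (∃! θ, θ ∈ D ∧ ∀ θ' ∈ D, L θ + lam * ∑ e, |θ e| ≤ L θ' + lam * ∑ e, |θ' e|) ∧
    ∀ θ, (θ ∈ D ∧ ∀ θ' ∈ D, L θ + lam * ∑ e, |θ e| ≤ L θ' + lam * ∑ e, |θ' e|) →
      ‖θ - θ₀‖ ≤ 1.5 * lam * √((Finset.univ.filter fun e => θ₀ e ≠ 0).card : ℝ) / β := by
  set F : EuclideanSpace ℝ ι → ℝ := fun θ => L θ + lam * ∑ e, |θ e| with hF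
  set κ := √((Finset.univ.filter fun e => θ₀ e ≠ 0).card : ℝ)
  have hconv1 : ConvexOn ℝ D fun θ : EuclideanSpace ℝ ι => lam * ∑ e, |θ e| := by
    refine ⟨hL.1, fun x _ y _ a b ha hb _ => ?_⟩
    have : ∑ e, |(a • x + b • y) e| ≤ a * ∑ e, |x e| + b * ∑ e, |y e| := by
      rw [Finset.mul_sum, Finset.mul_sum, ← Finset.sum_add_distrib]
      refine Finset.sum_le_sum fun e _ => ?_
      simp only [PiLp.add_apply, PiLp.smul_apply, smul_eq_mul]
      refine (abs_add_le _ _).trans ?_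
      rw [abs_mul, abs_mul, abs_of_nonneg ha, abs_of_nonneg hb]
    calc _ ≤ lam * (a * ∑ e, |x e| + b * ∑ e, |y e|) := mul_le_mul_of_nonneg_left this hlam0
      _ = _ := by simp only [smul_eq_mul]; ring
  have hFconv : StrictConvexOn ℝ D F := hL.add_convexOn hconv1
  have hFcont : ContinuousOn F (Metric.closedBall θ₀ r) :=
    hcont.add (Continuous.continuousOn (by fun_prop))
  have hθ₀ : θ₀ ∈ Metric.closedBall θ₀ r := Metric.mem_closedBall_self hr.le
  obtain ⟨θ₁, hθ₁, hmin⟩ := (isCompact_closedBall θ₀ r).exists_isMinOn ⟨θ₀, hθ₀⟩ hFcont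
  have hdist : ‖θ₁ - θ₀‖ ≤ 1.5 * lam * κ / β := by
    have h1 := hgrow θ₁ hθ₁
    have h2 := penalty_lower_bound θ₀ θ₁ g hg hlam hlam0
    have h3 : L θ₁ + lam * ∑ e, |θ₁ e| ≤ L θ₀ + lam * ∑ e, |θ₀ e| := hmin hθ₀
    rw [le_div_iff₀ hβ]
    by_contra! hlt
    have hpos : 0 < ‖θ₁ - θ₀‖ := by
      by_contra! h0
      have : 0 ≤ 1.5 * lam * κ := by positivity
      nlinarith
    nlinarith
  -- The minimizer over the closed ball lies in the open ball, so it is a local minimizer, hence a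
  -- global one by convexity.
  have hglob : IsMinOn F D θ₁ := by
    refine IsMinOn.of_isLocalMinOn_of_convexOn (hball hθ₁) ?_ hFconv.convexOn
    have hn : Metric.closedBall θ₀ r ∈ nhds θ₁ := by
      refine Filter.mem_of_superset (Metric.isOpen_ball.mem_nhds ?_) Metric.ball_subset_closedBall
      rw [Metric.mem_ball, dist_eq_norm]
      exact hdist.trans_lt hrad
    exact (hmin.isLocalMin hn).on D
  have huniq : ∀ θ, (θ ∈ D ∧ ∀ θ' ∈ D, F θ ≤ F θ') → θ = θ₁ := fun θ hθ =>
    hFconv.eq_of_isMinOn (fun θ' h' => hθ.2 θ' h') hglob hθ.1 (hball hθ₁)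
  exact ⟨⟨θ₁, ⟨hball hθ₁, fun θ' h' => hglob h'⟩, huniq⟩, fun θ hθ => huniq θ hθ ▸ hdist⟩

/-! ### Convexity and quadratic growth of log-partition functions. -/

/-- On `[-1, 1]` the Taylor remainder is at most `(2/9)|u|³`, and `1/2 - 2/9 ≥ 1/4`. Below `-1` the
tangent at `-1` suffices. The truncation makes the bound hold for all `u`, so it can be integrated.
-/
lemma one_add_add_min_sq_le_exp (u : ℝ) : 1 + u + min (u ^ 2) 1 / 4 ≤ Real.exp u := by
  rcases le_total (-1) u with h1 | h1
  · rcases le_total u 1 with h2 | h2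
    · have hu : |u| ≤ 1 := abs_le.2 ⟨h1, h2⟩
      have h := Real.exp_bound hu (n := 3) (by norm_num)
      norm_num [Finset.sum_range_succ, Nat.factorial] at h
      have h3 : |u| ^ 3 ≤ u ^ 2 := by
        rw [pow_succ, sq_abs]
        exact mul_le_of_le_one_right (sq_nonneg u) hu
      have := (abs_le.1 h).1
      have := min_le_left (u ^ 2) 1
      nlinarith
    · have := Real.quadratic_le_exp_of_nonneg (x := u) (by linarith)
      have := min_le_left (u ^ 2) 1
      nlinarith
  · have h2 : Real.exp u = Real.exp (-1) * Real.exp (u + 1) := by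
      rw [← Real.exp_add]; ring_nf
    have h3 := Real.add_one_le_exp (u + 1)
    have h4 : (1 : ℝ) / 4 ≤ Real.exp (-1) := by
      have := Real.exp_one_lt_d9
      rw [Real.exp_neg, ← one_div]
      exact one_div_le_one_div_of_le (Real.exp_pos 1) (by linarith)
    have h5 : Real.exp (-1) ≤ 1 := Real.exp_le_one_iff.2 (by norm_num)
    have h6 := min_le_right (u ^ 2) 1
    nlinarith [Real.exp_pos (-1)]

section ExponentialFamily

variable {ι α : Type*} [Fintype ι]

/-- The linear combination `∑ e, Δ e * T e x` of the sufficient statistics. -/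
noncomputable def pairing (T : ι → α → ℝ) (Δ : EuclideanSpace ℝ ι) (x : α) : ℝ :=
  ∑ e, Δ e * T e x

lemma pairing_add (T : ι → α → ℝ) (Δ Δ' : EuclideanSpace ℝ ι) (x : α) :
    pairing T (Δ + Δ') x = pairing T Δ x + pairing T Δ' x := by
  simp [pairing, add_mul, Finset.sum_add_distrib]

lemma pairing_sub (T : ι → α → ℝ) (Δ Δ' : EuclideanSpace ℝ ι) (x : α) :
    pairing T (Δ - Δ') x = pairing T Δ x - pairing T Δ' x := by
  simp [pairing, sub_mul, Finset.sum_sub_distrib]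

lemma pairing_smul (T : ι → α → ℝ) (c : ℝ) (Δ : EuclideanSpace ℝ ι) (x : α) :
    pairing T (c • Δ) x = c * pairing T Δ x := by
  simp [pairing, mul_assoc, Finset.mul_sum]

lemma pairing_single [DecidableEq ι] (T : ι → α → ℝ) (e : ι) (x : α) :
    pairing T (EuclideanSpace.single e 1) x = T e x := by
  simp [pairing]

variable [MeasurableSpace α]

/-- No nonzero linear combination of the statistics `T e` is almost surely constant. -/
def Nondegenerate (T : ι → α → ℝ) (Q : Measure α) : Prop :=
  ∀ (Δ : EuclideanSpace ℝ ι) (c : ℝ), (∀ᵐ x ∂Q, pairing T Δ x = c) → Δ = 0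

lemma measurable_pairing {T : ι → α → ℝ} (hT : ∀ e, Measurable (T e)) (Δ : EuclideanSpace ℝ ι) :
    Measurable (pairing T Δ) :=
  Finset.measurable_sum _ fun e _ => (hT e).const_mul _

/-- Hölder's inequality for exponential moments, with its equality case. -/
lemma strictConvexOn_log_integral_exp_pairing {T : ι → α → ℝ} (hT : ∀ e, Measurable (T e))
    {Q : Measure α} [NeZero Q] (hnd : Nondegenerate T Q) :
    StrictConvexOn ℝ {Δ | Integrable (fun x => Real.exp (pairing T Δ x)) Q}
      fun Δ => Real.log (∫ x, Real.exp (pairing T Δ x) ∂Q) := by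
  -- Convexity of `exp` at the shifted exponents. Shifts `0` give convexity of the domain; the
  -- log-partition values as shifts give Hölder's inequality on integration.
  have key : ∀ Δ₁ Δ₂ : EuclideanSpace ℝ ι, ∀ a b : ℝ, 0 ≤ a → 0 ≤ b → a + b = 1 →
      ∀ A₁ A₂ : ℝ, ∀ x, Real.exp (pairing T (a • Δ₁ + b • Δ₂) x) ≤ Real.exp (a * A₁ + b * A₂) *
        (a * (Real.exp (-A₁) * Real.exp (pairing T Δ₁ x)) +
          b * (Real.exp (-A₂) * Real.exp (pairing T Δ₂ x))) := by
    intro Δ₁ Δ₂ a b ha hb hab A₁ A₂ x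
    have h := convexOn_exp.2 (Set.mem_univ (pairing T Δ₁ x - A₁))
      (Set.mem_univ (pairing T Δ₂ x - A₂)) ha hb hab
    rw [pairing_add, pairing_smul, pairing_smul, ← Real.exp_add, ← Real.exp_add]
    calc _ = Real.exp (a * A₁ + b * A₂) *
          Real.exp (a • (pairing T Δ₁ x - A₁) + b • (pairing T Δ₂ x - A₂)) := by
          rw [← Real.exp_add]; simp only [smul_eq_mul]; ring_nf
      _ ≤ _ := by
          refine mul_le_mul_of_nonneg_left (h.trans_eq ?_) (Real.exp_pos _).le
          simp only [smul_eq_mul]; ring_nf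
  have hcv : Convex ℝ {Δ | Integrable (fun x => Real.exp (pairing T Δ x)) Q} := by
    intro Δ₁ h₁ Δ₂ h₂ a b ha hb hab
    refine Integrable.mono' ((((h₁.const_mul (Real.exp (-0))).const_mul a).add
      ((h₂.const_mul (Real.exp (-0))).const_mul b)).const_mul (Real.exp (a * 0 + b * 0)))
      (measurable_pairing hT _).exp.aestronglyMeasurable (.of_forall fun x => ?_)
    rw [Real.norm_eq_abs, Real.abs_exp]
    exact key Δ₁ Δ₂ a b ha hb hab 0 0 x
  refine ⟨hcv, fun Δ₁ h₁ Δ₂ h₂ hne a b ha hb hab => ?_⟩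
  have h₃ := hcv h₁ h₂ ha.le hb.le hab
  set A₁ := Real.log (∫ x, Real.exp (pairing T Δ₁ x) ∂Q) with hA₁
  set A₂ := Real.log (∫ x, Real.exp (pairing T Δ₂ x) ∂Q) with hA₂
  have e₁ : Real.exp (-A₁) * ∫ x, Real.exp (pairing T Δ₁ x) ∂Q = 1 := by
    rw [Real.exp_neg, hA₁, Real.exp_log (integral_exp_pos h₁)]
    exact inv_mul_cancel₀ (integral_exp_pos h₁).ne'
  have e₂ : Real.exp (-A₂) * ∫ x, Real.exp (pairing T Δ₂ x) ∂Q = 1 := by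
    rw [Real.exp_neg, hA₂, Real.exp_log (integral_exp_pos h₂)]
    exact inv_mul_cancel₀ (integral_exp_pos h₂).ne'
  set G : α → ℝ := fun x => Real.exp (a * A₁ + b * A₂) *
        (a * (Real.exp (-A₁) * Real.exp (pairing T Δ₁ x)) +
          b * (Real.exp (-A₂) * Real.exp (pairing T Δ₂ x))) with hG
  have hI₁ := (h₁.const_mul (Real.exp (-A₁))).const_mul a
  have hI₂ := (h₂.const_mul (Real.exp (-A₂))).const_mul b
  have hGi : Integrable G Q := (hI₁.add hI₂).const_mul _
  have hGv : ∫ x, G x ∂Q = Real.exp (a * A₁ + b * A₂) := by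
    rw [hG, integral_const_mul, integral_add hI₁ hI₂]
    simp only [integral_const_mul]
    rw [e₁, e₂, mul_one, mul_one, hab, mul_one]
  have hle : ∀ x, Real.exp (pairing T (a • Δ₁ + b • Δ₂) x) ≤ G x :=
    key Δ₁ Δ₂ a b ha.le hb.le hab A₁ A₂
  have hlt : ∫ x, Real.exp (pairing T (a • Δ₁ + b • Δ₂) x) ∂Q < ∫ x, G x ∂Q := by
    refine lt_of_le_of_ne (integral_mono h₃ hGi hle) fun heq => hne ?_
    -- Equality of integrals forces pointwise equality a.e.; strict convexity of `exp` then makes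
    -- the shifted exponents agree, against nondegeneracy.
    have hae := (integral_eq_iff_of_ae_le h₃ hGi (.of_forall hle)).1 heq
    refine sub_eq_zero.1 (hnd (Δ₁ - Δ₂) (A₁ - A₂) ?_)
    filter_upwards [hae] with x hx
    by_contra hxne
    have hne' : pairing T Δ₁ x - A₁ ≠ pairing T Δ₂ x - A₂ := by
      rw [pairing_sub] at hxne
      intro h; apply hxne; linarith
    have h := strictConvexOn_exp.2 (Set.mem_univ (pairing T Δ₁ x - A₁))
      (Set.mem_univ (pairing T Δ₂ x - A₂)) hne' ha hb hab
    refine hx.not_lt ?_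
    simp only [hG]
    rw [pairing_add, pairing_smul, pairing_smul, ← Real.exp_add, ← Real.exp_add]
    calc _ = Real.exp (a * A₁ + b * A₂) *
          Real.exp (a • (pairing T Δ₁ x - A₁) + b • (pairing T Δ₂ x - A₂)) := by
          rw [← Real.exp_add]; simp only [smul_eq_mul]; ring_nf
      _ < _ := by
          refine mul_lt_mul_of_pos_left (h.trans_eq ?_) (Real.exp_pos _)
          simp only [smul_eq_mul]; ring_nf
  rw [hGv] at hlt
  simpa only [smul_eq_mul, Real.log_exp] using Real.log_lt_log (integral_exp_pos h₃) hlt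

lemma min_sq_mul_le {t y : ℝ} (ht : t ^ 2 ≤ 1) :
    t ^ 2 * min (y ^ 2) 1 ≤ min ((t * y) ^ 2) 1 := by
  refine le_min ?_ ?_
  · rw [mul_pow]; exact mul_le_mul_of_nonneg_left (min_le_left _ _) (sq_nonneg t)
  · exact mul_le_one₀ ht (le_min (sq_nonneg y) zero_le_one) (min_le_right _ _)

/-- A nondegenerate family of centered statistics has uniformly nondegenerate truncated second
moments. -/
lemma exists_truncated_second_moment_lower_bound [Nonempty ι] {Y : ι → α → ℝ}
    (hY : ∀ e, Measurable (Y e)) {Q : Measure α} [IsProbabilityMeasure Q]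
    (hnd : Nondegenerate Y Q) :
    ∃ δ : ℝ, 0 < δ ∧ ∀ Δ : EuclideanSpace ℝ ι, ‖Δ‖ ≤ 1 →
      δ * ‖Δ‖ ^ 2 ≤ ∫ x, min (pairing Y Δ x ^ 2) 1 ∂Q := by
  have hbd : ∀ (Δ : EuclideanSpace ℝ ι) x, ‖min (pairing Y Δ x ^ 2) 1‖ ≤ 1 := fun Δ x => by
    rw [Real.norm_of_nonneg (le_min (sq_nonneg _) zero_le_one)]
    exact min_le_right _ _
  have hms : ∀ Δ : EuclideanSpace ℝ ι, Measurable fun x => min (pairing Y Δ x ^ 2) 1 :=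
    fun Δ => ((measurable_pairing hY Δ).pow_const 2).min measurable_const
  have hint : ∀ Δ : EuclideanSpace ℝ ι, Integrable (fun x => min (pairing Y Δ x ^ 2) 1) Q :=
    fun Δ => .of_bound (hms Δ).aestronglyMeasurable 1 (.of_forall (hbd Δ))
  -- Truncation gives the dominating function `1`, so no moments are needed. The minimum over the
  -- unit sphere is then attained, and scaling carries it to the ball.
  have hcont : Continuous fun Δ : EuclideanSpace ℝ ι => ∫ x, min (pairing Y Δ x ^ 2) 1 ∂Q := by
    refine continuous_of_dominated (bound := fun _ => 1)
      (fun Δ => (hms Δ).aestronglyMeasurable) (fun Δ => .of_forall (hbd Δ))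
      (integrable_const _) (.of_forall fun x => ?_)
    unfold pairing
    fun_prop
  have hne : (Metric.sphere (0 : EuclideanSpace ℝ ι) 1).Nonempty :=
    NormedSpace.sphere_nonempty.2 zero_le_one
  obtain ⟨v, hv, hmin⟩ := (isCompact_sphere (0 : EuclideanSpace ℝ ι) 1).exists_isMinOn hne
    hcont.continuousOn
  have hnn : ∀ (Δ : EuclideanSpace ℝ ι) x, 0 ≤ min (pairing Y Δ x ^ 2) 1 := fun Δ x =>
    le_min (sq_nonneg _) zero_le_one
  refine ⟨∫ x, min (pairing Y v x ^ 2) 1 ∂Q, ?_, fun Δ hΔ => ?_⟩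
  · refine lt_of_le_of_ne (integral_nonneg (hnn v)) fun h0 => ?_
    have hae := (integral_eq_zero_iff_of_nonneg (hnn v) (hint v)).1 h0.symm
    have hv0 : v = 0 := by
      refine hnd v 0 ?_
      filter_upwards [hae] with x hx
      by_contra hne
      have : 0 < min (pairing Y v x ^ 2) 1 := lt_min (by positivity) one_pos
      exact this.ne' hx
    rw [hv0] at hv
    simp at hv
  · rcases eq_or_ne Δ 0 with rfl | hne0
    · simpa using integral_nonneg (hnn 0)
    have hpos : 0 < ‖Δ‖ := norm_pos_iff.2 hne0
    have hmem : ‖Δ‖⁻¹ • Δ ∈ Metric.sphere (0 : EuclideanSpace ℝ ι) 1 := by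
      simp [norm_smul, hpos.ne']
    calc _ ≤ (∫ x, min (pairing Y (‖Δ‖⁻¹ • Δ) x ^ 2) 1 ∂Q) * ‖Δ‖ ^ 2 :=
          mul_le_mul_of_nonneg_right (hmin hmem) (sq_nonneg _)
      _ = ∫ x, ‖Δ‖ ^ 2 * min (pairing Y (‖Δ‖⁻¹ • Δ) x ^ 2) 1 ∂Q := by
          rw [integral_const_mul, mul_comm]
      _ ≤ _ := by
          refine integral_mono ((hint _).const_mul _) (hint _) fun x => ?_
          refine (min_sq_mul_le (by nlinarith)).trans_eq ?_
          rw [pairing_smul, ← mul_assoc, mul_inv_cancel₀ hpos.ne', one_mul]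

/-- Local quadratic growth of the log-partition function, relative to its linear part. -/
lemma exists_quadratic_growth_log_integral_exp [Nonempty ι] {T : ι → α → ℝ}
    (hT : ∀ e, Measurable (T e)) {Q : Measure α} [IsProbabilityMeasure Q]
    (hnd : Nondegenerate T Q) (hTi : ∀ e, Integrable (T e) Q) :
    ∃ β : ℝ, 0 < β ∧ ∀ Δ : EuclideanSpace ℝ ι, ‖Δ‖ ≤ 1 →
      Integrable (fun x => Real.exp (pairing T Δ x)) Q →
      β * ‖Δ‖ ^ 2 ≤
        Real.log (∫ x, Real.exp (pairing T Δ x) ∂Q) - ∑ e, Δ e * ∫ x, T e x ∂Q := by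
  set Y : ι → α → ℝ := fun e x => T e x - ∫ y, T e y ∂Q with hYdef
  have hY : ∀ e, Measurable (Y e) := fun e => (hT e).sub_const _
  have hYT : ∀ (Δ : EuclideanSpace ℝ ι) x,
      pairing Y Δ x = pairing T Δ x - ∑ e, Δ e * ∫ y, T e y ∂Q := fun Δ x => by
    simp [pairing, hYdef, mul_sub, Finset.sum_sub_distrib]
  have hTΔ : ∀ Δ : EuclideanSpace ℝ ι, Integrable (pairing T Δ) Q := fun Δ =>
    integrable_finsetSum _ fun e _ => (hTi e).const_mul _
  have hYnd : Nondegenerate Y Q := fun Δ c hc => by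
    refine hnd Δ (c + ∑ e, Δ e * ∫ y, T e y ∂Q) ?_
    filter_upwards [hc] with x hx
    rw [← hx, hYT]; ring
  obtain ⟨δ, hδ, hlow⟩ := exists_truncated_second_moment_lower_bound hY hYnd
  refine ⟨δ / 8, by positivity, fun Δ hΔ hint => ?_⟩
  set m := ∑ e, Δ e * ∫ x, T e x ∂Q with hm
  have hmint : ∫ x, pairing T Δ x ∂Q = m := by
    simp only [pairing]
    rw [integral_finsetSum _ fun e _ => (hTi e).const_mul _]
    simp only [integral_const_mul, hm]
  set M := ∫ x, min (pairing Y Δ x ^ 2) 1 ∂Q with hMdef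
  have hMi : Integrable (fun x => min (pairing Y Δ x ^ 2) 1) Q :=
    .of_bound (((measurable_pairing hY Δ).pow_const 2).min
      measurable_const).aestronglyMeasurable 1 (.of_forall fun x => by
        rw [Real.norm_of_nonneg (le_min (sq_nonneg _) zero_le_one)]
        exact min_le_right _ _)
  have hM1 : M ≤ 1 := by
    calc M ≤ ∫ _, (1 : ℝ) ∂Q := integral_mono hMi (integrable_const _) fun x => min_le_right _ _
      _ = 1 := by simp
  have hM0 : 0 ≤ M := integral_nonneg fun x => le_min (sq_nonneg _) zero_le_one
  have hexp : 1 + M / 4 ≤ Real.exp (-m) * ∫ x, Real.exp (pairing T Δ x) ∂Q := by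
    have hYi : Integrable (pairing Y Δ) Q := by
      refine ((hTΔ Δ).sub (integrable_const m)).congr (.of_forall fun x => ?_)
      simp [hYT, hm]
    have hY0 : ∫ x, pairing Y Δ x ∂Q = 0 := by
      simp only [hYT]
      rw [integral_sub (hTΔ Δ) (integrable_const _), hmint]
      simp [hm]
    have hYi1 : Integrable (fun x => 1 + pairing Y Δ x) Q := (integrable_const _).add hYi
    calc 1 + M / 4 = ∫ x, (1 + pairing Y Δ x + min (pairing Y Δ x ^ 2) 1 / 4) ∂Q := by
          rw [integral_add hYi1 (hMi.div_const 4),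
            integral_add (integrable_const _) hYi, hY0, integral_div]
          simp [hMdef]
      _ ≤ ∫ x, Real.exp (-m) * Real.exp (pairing T Δ x) ∂Q := by
          refine integral_mono (hYi1.add (hMi.div_const 4))
            (hint.const_mul _) fun x => ?_
          refine (one_add_add_min_sq_le_exp _).trans_eq ?_
          rw [← Real.exp_add, hYT, ← hm, neg_add_eq_sub]
      _ = _ := integral_const_mul _ _
  have hlog : Real.log (1 + M / 4) ≤ -m + Real.log (∫ x, Real.exp (pairing T Δ x) ∂Q) := by
    refine (Real.log_le_log (by positivity) hexp).trans_eq ?_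
    rw [Real.log_mul (Real.exp_pos _).ne' (integral_exp_pos hint).ne', Real.log_exp]
  -- From `log (1 + x) ≥ x / (1 + x) ≥ x / 2` for `x = M / 4 ≤ 1`.
  have hlow' : M / 8 ≤ Real.log (1 + M / 4) := by
    refine le_trans ?_ (Real.one_sub_inv_le_log_of_pos (by positivity))
    rw [le_sub_comm, inv_le_comm₀ (by positivity) (by linarith), ← one_div,
      div_le_iff₀ (by linarith)]
    nlinarith
  have := hlow Δ hΔ
  linarith

end ExponentialFamily

/-! ### The pairwise model as an exponential family. -/

section Facts

variable {𝒳 : Type*} {p : ℕ}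

/-- The sufficient statistic `φ(x_s, x_t)` of the pair `(s, t)`. -/
def pairStat (φ : 𝒳 → 𝒳 → ℝ) (e : Pairs p) (x : Fin p → 𝒳) : ℝ := φ (x e.1.1) (x e.1.2)

lemma energy_eq_add_pairing (f : 𝒳 → ℝ) (φ : 𝒳 → 𝒳 → ℝ) (θ θ' : Param p) (x : Fin p → 𝒳) :
    energy f φ θ' x = energy f φ θ x + pairing (pairStat φ) (θ' - θ) x := by
  simp only [energy, pairing, pairStat, PiLp.sub_apply, sub_mul, Finset.sum_sub_distrib]
  ring

lemma IsMercerKernel.abs_le {φ : 𝒳 → 𝒳 → ℝ} (hφ : IsMercerKernel φ) (x y : 𝒳) :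
    |φ x y| ≤ (φ x x + φ y y) / 2 := by
  have h := hφ 2 ![x, y]
  have hsymm : φ y x = φ x y := by simpa using h.isHermitian.apply 0 1
  have h1 := h.dotProduct_mulVec_nonneg ![1, 1]
  have h2 := h.dotProduct_mulVec_nonneg ![1, -1]
  simp [dotProduct, Matrix.mulVec, Fin.sum_univ_two] at h1 h2
  rw [_root_.abs_le]
  constructor <;> linarith

/-- The weighted degree `∑_{e ∋ s} |θ_e|` of a vertex. -/
noncomputable def weightedDegree (θ : Param p) (s : Fin p) : ℝ :=
  ∑ e : Pairs p, |θ e| * ((if e.1.1 = s then 1 else 0) + if e.1.2 = s then 1 else 0)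

lemma sum_abs_mul_add_eq (θ : Param p) (d : Fin p → ℝ) :
    ∑ e : Pairs p, |θ e| * (d e.1.1 + d e.1.2) = ∑ s, weightedDegree θ s * d s := by
  simp only [weightedDegree, Finset.sum_mul]
  rw [Finset.sum_comm]
  refine Finset.sum_congr rfl fun e _ => ?_
  simp only [mul_assoc, ← Finset.mul_sum, add_mul, Finset.sum_add_distrib, ite_mul, one_mul,
    zero_mul, Finset.sum_ite_eq, Finset.mem_univ, if_true]

lemma weightedDegree_le {θ : Param p} {b : ℝ} (hb : ∀ e, |θ e| ≤ b) (s : Fin p) :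
    weightedDegree θ s ≤ b * degree θ s := by
  classical
  have : b * (degree θ s : ℝ) =
      ∑ e : Pairs p, if θ e ≠ 0 ∧ (e.1.1 = s ∨ e.1.2 = s) then b else 0 := by
    rw [← Finset.sum_filter, Finset.sum_const, nsmul_eq_mul, mul_comm, degree]
  rw [this, weightedDegree]
  refine Finset.sum_le_sum fun e _ => ?_
  have hlt := e.2
  have hbe := hb e
  by_cases h0 : θ e = 0
  · simp [h0]
  by_cases h1 : e.1.1 = s
  · have h2 : e.1.2 ≠ s := fun h2 => absurd hlt (by rw [h1, h2]; exact lt_irrefl s)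
    simpa [h0, h1, h2] using hbe
  · by_cases h2 : e.1.2 = s
    · simpa [h0, h1, h2] using hbe
    · simp [h1, h2]

variable [MeasurableSpace 𝒳] {ν : Measure 𝒳} {f : 𝒳 → ℝ} {φ : 𝒳 → 𝒳 → ℝ}

lemma measurable_pairStat (hφm : Measurable (Function.uncurry φ)) (e : Pairs p) :
    Measurable (pairStat φ e) :=
  hφm.comp (f := fun x : Fin p → 𝒳 => (x e.1.1, x e.1.2)) (by fun_prop)

lemma measurable_energy (hφm : Measurable (Function.uncurry φ)) (hf : ∀ x, f x = -φ x x)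
    (θ : Param p) : Measurable (energy f φ θ) := by
  have hfm : Measurable f := by
    rw [funext hf]
    exact (hφm.comp (measurable_id.prodMk measurable_id)).neg
  exact (Finset.measurable_sum _ fun s _ => hfm.comp (measurable_pi_apply s)).add
    (Finset.measurable_sum _ fun e _ => (measurable_pairStat hφm e).const_mul _)

/-- The Mercer bound `IsMercerKernel.abs_le` dominates each interaction by diagonal terms, so the
energy is at most `-∑ s, (1 - weightedDegree θ s / 2) * φ (x s) (x s)` and the integral factorizes.
-/
lemma mem_domain_of_weightedDegree_lt [SigmaFinite ν] (hφm : Measurable (Function.uncurry φ))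
    (hφ : IsMercerKernel φ)
    (hint : ∀ c : ℝ, 0 < c → Integrable (fun x => Real.exp (-c * φ x x)) ν)
    (hf : ∀ x, f x = -φ x x) {θ : Param p} (hθ : ∀ s, weightedDegree θ s < 2) :
    θ ∈ domain ν f φ := by
  have hprod : Integrable (fun x : Fin p → 𝒳 =>
      ∏ s, Real.exp (-(1 - weightedDegree θ s / 2) * φ (x s) (x s)))
      (Measure.pi fun _ : Fin p => ν) :=
    Integrable.fintype_prod_dep (f := fun s y => Real.exp (-(1 - weightedDegree θ s / 2) * φ y y))
      fun s => hint _ (by linarith [hθ s])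
  refine hprod.mono' (measurable_energy hφm hf θ).exp.aestronglyMeasurable
    (.of_forall fun x => ?_)
  rw [Real.norm_eq_abs, Real.abs_exp, ← Real.exp_sum, Real.exp_le_exp]
  have h1 : ∑ e : Pairs p, θ e * φ (x e.1.1) (x e.1.2) ≤
      ∑ e : Pairs p, |θ e| * (φ (x e.1.1) (x e.1.1) / 2 + φ (x e.1.2) (x e.1.2) / 2) := by
    refine Finset.sum_le_sum fun e _ => (le_abs_self _).trans ?_
    rw [abs_mul, ← add_div]
    exact mul_le_mul_of_nonneg_left (hφ.abs_le _ _) (abs_nonneg _)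
  rw [sum_abs_mul_add_eq θ fun s => φ (x s) (x s) / 2] at h1
  calc energy f φ θ x ≤ ∑ s, f (x s) + ∑ s, weightedDegree θ s * (φ (x s) (x s) / 2) := by
        unfold energy; gcongr
    _ = _ := by
        rw [← Finset.sum_add_distrib]
        exact Finset.sum_congr rfl fun s _ => by rw [hf]; ring

lemma mem_interior_domain [SigmaFinite ν] (hφm : Measurable (Function.uncurry φ))
    (hφ : IsMercerKernel φ)
    (hint : ∀ c : ℝ, 0 < c → Integrable (fun x => Real.exp (-c * φ x x)) ν)
    (hf : ∀ x, f x = -φ x x) {θ : Param p} (hθ : ∀ e, |θ e| ≤ 0.25)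
    (hdeg : ∀ s, degree θ s < 8) : θ ∈ interior (domain ν f φ) := by
  have hopen : IsOpen {θ : Param p | ∀ s, weightedDegree θ s < 2} := by
    simp only [Set.ofPred_forall]
    refine isOpen_iInter_of_finite fun s => isOpen_lt ?_ continuous_const
    unfold weightedDegree
    fun_prop
  refine mem_interior.2 ⟨_, fun θ' h => mem_domain_of_weightedDegree_lt hφm hφ hint hf h,
    hopen, fun s => ?_⟩
  have h1 := weightedDegree_le hθ s
  -- The weighted degree is at most `7 / 4 < 2`.
  have h2 : (degree θ s : ℝ) ≤ 7 := by exact_mod_cast Nat.le_of_lt_succ (hdeg s)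
  norm_num at h1
  linarith

/-- For a zero base measure all parameters would give the same (zero) law. -/
lemma neZero_pi_of_minimalRepresentation [Nonempty (Pairs p)] {θ : Param p}
    (hmin : MinimalRepresentation ν f φ θ) : NeZero (Measure.pi fun _ : Fin p => ν) := by
  classical
  refine ⟨fun h0 => ?_⟩
  obtain ⟨e⟩ := ‹Nonempty (Pairs p)›
  have h := hmin (θ + EuclideanSpace.single e 1) (by simp [domain, h0]) (by simp [law, h0])
  have := congrArg (fun v : Param p => v e) h
  simp at this

lemma negLogLik_eq {n : ℕ} (hn : 0 < n) (x : Fin n → Fin p → 𝒳) (θ : Param p) :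
    negLogLik ν f φ x θ =
      logPartition ν f φ θ - (1 / (n : ℝ)) * ∑ i, energy f φ θ (x i) := by
  have hn' : (n : ℝ) ≠ 0 := by positivity
  simp only [negLogLik, density, Real.log_exp, Finset.sum_sub_distrib, Finset.sum_const,
    Finset.card_univ, Fintype.card_fin, nsmul_eq_mul]
  field_simp
  ring

variable [NeZero (Measure.pi fun _ : Fin p => ν)]

lemma density_eq_div {θ : Param p} (hθ : θ ∈ domain ν f φ) (x : Fin p → 𝒳) :
    density ν f φ θ x = Real.exp (energy f φ θ x) /
      ∫ y, Real.exp (energy f φ θ y) ∂(Measure.pi fun _ : Fin p => ν) := by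
  rw [density, Real.exp_sub, logPartition, Real.exp_log (integral_exp_pos hθ)]

lemma law_eq_tilted {θ : Param p} (hθ : θ ∈ domain ν f φ) :
    law ν f φ θ = (Measure.pi fun _ : Fin p => ν).tilted (energy f φ θ) := by
  simp only [law, Measure.tilted, density_eq_div hθ]

lemma isProbabilityMeasure_law {θ : Param p} (hθ : θ ∈ domain ν f φ) :
    IsProbabilityMeasure (law ν f φ θ) := by
  rw [law_eq_tilted hθ]
  exact isProbabilityMeasure_tilted hθ

lemma integrable_exp_pairing_law_iff {θ θ' : Param p} (hθ : θ ∈ domain ν f φ) :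
    Integrable (fun x => Real.exp (pairing (pairStat φ) (θ' - θ) x)) (law ν f φ θ) ↔
      θ' ∈ domain ν f φ := by
  rw [law_eq_tilted hθ, integrable_tilted_iff hθ]
  simp only [domain, Set.mem_ofPred_eq, energy_eq_add_pairing f φ θ θ', Real.exp_add, smul_eq_mul]

lemma log_integral_exp_pairing_law {θ θ' : Param p} (hθ : θ ∈ domain ν f φ)
    (hθ' : θ' ∈ domain ν f φ) :
    Real.log (∫ x, Real.exp (pairing (pairStat φ) (θ' - θ) x) ∂(law ν f φ θ)) =
      logPartition ν f φ θ' - logPartition ν f φ θ := by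
  have hE : energy f φ θ + pairing (pairStat φ) (θ' - θ) = energy f φ θ' :=
    funext fun x => (energy_eq_add_pairing f φ θ θ' x).symm
  rw [law_eq_tilted hθ, integral_exp_tilted, hE,
    Real.log_div (integral_exp_pos hθ').ne' (integral_exp_pos hθ).ne']
  rfl

/-- If the combination with coefficients `Δ` is a.s. `c`, moving from `θ` to `θ + Δ` multiplies the
unnormalized density by `exp c`. Normalization cancels this factor, so the laws coincide and
minimality gives `Δ = 0`. -/
lemma nondegenerate_law {θ : Param p} (hθ : θ ∈ domain ν f φ)
    (hmin : MinimalRepresentation ν f φ θ) : Nondegenerate (pairStat φ) (law ν f φ θ) := by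
  intro Δ c hc
  rw [law_eq_tilted hθ] at hc
  have hc' := (absolutelyContinuous_tilted hθ).ae_le hc
  have hE : ∀ᵐ x ∂(Measure.pi fun _ : Fin p => ν),
      Real.exp (energy f φ (θ + Δ) x) = Real.exp c * Real.exp (energy f φ θ x) := by
    filter_upwards [hc'] with x hx
    rw [energy_eq_add_pairing f φ θ, add_sub_cancel_left, hx, ← Real.exp_add, add_comm]
  have hmem : θ + Δ ∈ domain ν f φ :=
    (Integrable.const_mul hθ (Real.exp c)).congr (hE.mono fun _ h => h.symm)
  have h := hmin (θ + Δ) hmem ?_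
  · simpa using h
  · refine withDensity_congr_ae ?_
    filter_upwards [hE] with x hx
    rw [density_eq_div hmem, density_eq_div hθ, hx, integral_congr_ae hE, integral_const_mul,
      mul_div_mul_left _ _ (Real.exp_pos c).ne']

/-- The sample mean of the sufficient statistic of the pair `e`. -/
noncomputable def sampleStat (φ : 𝒳 → 𝒳 → ℝ) {n : ℕ} (x : Fin n → Fin p → 𝒳) (e : Pairs p) : ℝ :=
  (1 / (n : ℝ)) * ∑ i, pairStat φ e (x i)

lemma negLogLik_eq_add {n : ℕ} (hn : 0 < n) (x : Fin n → Fin p → 𝒳) {θ θ' : Param p}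
    (hθ : θ ∈ domain ν f φ) (hθ' : θ' ∈ domain ν f φ) :
    negLogLik ν f φ x θ' = negLogLik ν f φ x θ +
      (Real.log (∫ y, Real.exp (pairing (pairStat φ) (θ' - θ) y) ∂(law ν f φ θ)) -
        ∑ e, (θ' - θ) e * sampleStat φ x e) := by
  rw [log_integral_exp_pairing_law hθ hθ', negLogLik_eq hn, negLogLik_eq hn]
  have h : ∑ e, (θ' - θ) e * sampleStat φ x e =
      (1 / (n : ℝ)) * ∑ i, pairing (pairStat φ) (θ' - θ) (x i) := by
    simp only [sampleStat, pairing, Finset.mul_sum]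
    rw [Finset.sum_comm]
    exact Finset.sum_congr rfl fun i _ => Finset.sum_congr rfl fun e _ => by ring
  simp only [h, energy_eq_add_pairing f φ θ θ', Finset.sum_add_distrib]
  ring

/-- Exponential moments on both sides of `0` provide all moments of the statistics and the
derivative of their cumulant generating functions. -/
lemma zero_mem_interior_integrableExpSet_pairStat {θ : Param p}
    (hθ : θ ∈ interior (domain ν f φ)) (e : Pairs p) :
    0 ∈ interior (integrableExpSet (pairStat φ e) (law ν f φ θ)) := by
  classical
  have hcont : Continuous fun t : ℝ => θ + t • EuclideanSpace.single e (1 : ℝ) := by fun_prop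
  refine mem_interior.2 ⟨_, fun t ht => ?_, isOpen_interior.preimage hcont, by simpa using hθ⟩
  have h := (integrable_exp_pairing_law_iff (interior_subset hθ)).2 (interior_subset ht)
  simpa only [add_sub_cancel_left, pairing_smul, pairing_single, integrableExpSet,
    Set.mem_ofPred_eq] using h

lemma lineDeriv_negLogLik {n : ℕ} (hn : 0 < n) (x : Fin n → Fin p → 𝒳) {θ : Param p}
    (hθ : θ ∈ interior (domain ν f φ)) (e : Pairs p) :
    lineDeriv ℝ (negLogLik ν f φ x) θ (EuclideanSpace.single e 1) =
      ∫ y, pairStat φ e y ∂(law ν f φ θ) - sampleStat φ x e := by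
  classical
  have hθD := interior_subset hθ
  have := isProbabilityMeasure_law hθD
  have h0 := zero_mem_interior_integrableExpSet_pairStat hθ e
  have hcont : Continuous fun t : ℝ => θ + t • EuclideanSpace.single e (1 : ℝ) := by fun_prop
  have hev : (fun t : ℝ => negLogLik ν f φ x (θ + t • EuclideanSpace.single e 1)) =ᶠ[nhds 0]
      fun t => negLogLik ν f φ x θ +
        (cgf (pairStat φ e) (law ν f φ θ) t - t * sampleStat φ x e) := by
    filter_upwards [(isOpen_interior.preimage hcont).mem_nhds (by simpa using hθ)] with t ht
    rw [negLogLik_eq_add hn x hθD (interior_subset ht)]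
    simp only [add_sub_cancel_left, pairing_smul, pairing_single, cgf, mgf]
    simp
  have hd : HasDerivAt (cgf (pairStat φ e) (law ν f φ θ))
      (∫ y, pairStat φ e y ∂(law ν f φ θ)) 0 := by
    have h := (analyticAt_cgf h0).differentiableAt.hasDerivAt
    rwa [deriv_cgf_zero h0, probReal_univ, div_one] at h
  rw [lineDeriv, hev.deriv_eq]
  have h := ((hd.sub ((hasDerivAt_id (0 : ℝ)).mul_const (sampleStat φ x e))).const_add
    (negLogLik ν f φ x θ)).deriv
  simpa using h

end Facts

/-- Chebyshev's inequality for the sample mean of a statistic of an i.i.d. sample. -/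
lemma measure_abs_integral_sub_sampleMean_ge_le {α : Type*} [MeasurableSpace α] {Q : Measure α}
    {T : α → ℝ} (hT : Measurable T) (hT2 : MemLp T 2 Q) {Ω : Type*} [MeasurableSpace Ω]
    {P : Measure Ω} [IsProbabilityMeasure P] {n : ℕ} (hn : 0 < n) {X : Fin n → Ω → α}
    (hX : ∀ i, HasLaw (X i) Q P) (hind : iIndepFun X P) {t : ℝ} (ht : 0 < t) :
    P {ω | t ≤ |∫ y, T y ∂Q - (1 / (n : ℝ)) * ∑ i, T (X i ω)|} ≤
      ENNReal.ofReal (Var[T; Q] / (n * t ^ 2)) := by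
  have hn' : (0 : ℝ) < n := by exact_mod_cast hn
  have hmem : ∀ i ∈ Finset.univ, MemLp (T ∘ X i) 2 P := fun i _ =>
    MemLp.comp_of_map (by rw [(hX i).map_eq]; exact hT2) (hX i).aemeasurable
  have hvar : Var[∑ i, T ∘ X i; P] = n * Var[T; Q] := by
    rw [IndepFun.variance_sum hmem fun i _ j _ hij =>
      (hind.indepFun hij).comp hT hT]
    have : ∀ i, Var[T ∘ X i; P] = Var[T; Q] := fun i => by
      rw [← (hX i).map_eq, variance_map (by rw [(hX i).map_eq]; exact hT.aemeasurable)
        (hX i).aemeasurable]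
    simp [this]
  have hmean : ∫ ω, (∑ i, T ∘ X i) ω ∂P = n * ∫ y, T y ∂Q := by
    simp only [Finset.sum_apply]
    rw [integral_finsetSum _ fun i hi => (hmem i hi).integrable one_le_two]
    have : ∀ i, ∫ ω, (T ∘ X i) ω ∂P = ∫ y, T y ∂Q := fun i =>
      (hX i).integral_comp hT.aestronglyMeasurable
    rw [Finset.sum_congr rfl fun i _ => this i]
    simp
  have hcheb := meas_ge_le_variance_div_sq (memLp_finsetSum' _ hmem)
    (c := n * t) (by positivity)
  rw [hvar, hmean] at hcheb
  refine (measure_mono fun ω hω => ?_).trans (hcheb.trans_eq ?_)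
  · simp only [Set.mem_ofPred_eq, Finset.sum_apply, Function.comp_apply] at hω ⊢
    have : ∑ i, T (X i ω) - n * ∫ y, T y ∂Q =
        -(n * (∫ y, T y ∂Q - (1 / (n : ℝ)) * ∑ i, T (X i ω))) := by
      field_simp
      ring
    rw [this, abs_neg, abs_mul, abs_of_pos hn']
    exact mul_le_mul_of_nonneg_left hω hn'.le
  · congr 1
    field_simp

/-! ### The joint estimator and its gradient bound. -/

section Estimator

variable {𝒳 : Type*} {p : ℕ} [MeasurableSpace 𝒳] {ν : Measure 𝒳} {f : 𝒳 → ℝ} {φ : 𝒳 → 𝒳 → ℝ}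
  [NeZero (Measure.pi fun _ : Fin p => ν)]

lemma strictConvexOn_negLogLik (hφm : Measurable (Function.uncurry φ)) {n : ℕ} (hn : 0 < n)
    (x : Fin n → Fin p → 𝒳) {θ : Param p} (hθ : θ ∈ domain ν f φ)
    (hmin : MinimalRepresentation ν f φ θ) :
    StrictConvexOn ℝ (domain ν f φ) (negLogLik ν f φ x) := by
  have := isProbabilityMeasure_law hθ
  have hΛ := strictConvexOn_log_integral_exp_pairing (measurable_pairStat hφm)
    (nondegenerate_law hθ hmin)
  have hmem : ∀ θ' ∈ domain ν f φ, θ' - θ ∈ {Δ : Param p |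
      Integrable (fun x => Real.exp (pairing (pairStat φ) Δ x)) (law ν f φ θ)} := fun θ' h =>
    (integrable_exp_pairing_law_iff hθ).2 h
  have hcomb : ∀ (x y : Param p) (a b : ℝ), a + b = 1 →
      a • x + b • y - θ = a • (x - θ) + b • (y - θ) := fun x y a b hab => by
    have : θ = (a + b) • θ := by rw [hab, one_smul]
    nth_rewrite 1 [this]
    module
  have hconv : Convex ℝ (domain ν f φ) := fun x hx y hy a b ha hb hab => by
    rw [← integrable_exp_pairing_law_iff hθ, hcomb x y a b hab]
    exact hΛ.1 (hmem x hx) (hmem y hy) ha hb hab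
  refine ⟨hconv, fun θ₁ h₁ θ₂ h₂ hne a b ha hb hab => ?_⟩
  rw [negLogLik_eq_add hn x hθ (hconv h₁ h₂ ha.le hb.le hab), negLogLik_eq_add hn x hθ h₁,
    negLogLik_eq_add hn x hθ h₂, hcomb _ _ a b hab]
  have h := hΛ.2 (hmem _ h₁) (hmem _ h₂) (fun h => hne (sub_left_injective h)) ha hb hab
  have hlin : ∑ e, (a • (θ₁ - θ) + b • (θ₂ - θ)) e * sampleStat φ x e =
      a * ∑ e, (θ₁ - θ) e * sampleStat φ x e + b * ∑ e, (θ₂ - θ) e * sampleStat φ x e := by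
    rw [Finset.mul_sum, Finset.mul_sum, ← Finset.sum_add_distrib]
    refine Finset.sum_congr rfl fun e _ => ?_
    simp only [PiLp.add_apply, PiLp.smul_apply, smul_eq_mul]
    ring
  rw [hlin]
  simp only [smul_eq_mul] at h ⊢
  have hb' : b = 1 - a := by linarith
  subst hb'
  linarith

lemma abs_partial_le_gradSupNorm {n : ℕ} (hn : 0 < n) (x : Fin n → Fin p → 𝒳) {θ : Param p}
    (hθ : θ ∈ interior (domain ν f φ)) (e : Pairs p) :
    |∫ y, pairStat φ e y ∂(law ν f φ θ) - sampleStat φ x e| ≤ gradSupNorm ν f φ x θ := by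
  simp only [gradSupNorm, lineDeriv_negLogLik hn x hθ]
  exact le_ciSup (f := fun e => |∫ y, pairStat φ e y ∂(law ν f φ θ) - sampleStat φ x e|)
    (Set.finite_range _).bddAbove e

/-- The deterministic part: existence, uniqueness and error bound of the joint estimator, for
constants that depend only on the model. -/
lemma exists_error_bound_jointEstimator [Nonempty (Pairs p)]
    (hφm : Measurable (Function.uncurry φ)) {θ : Param p} (hθ : θ ∈ interior (domain ν f φ))
    (hmin : MinimalRepresentation ν f φ θ) :
    ∃ r β : ℝ, 0 < r ∧ 0 < β ∧ ∀ n : ℕ, 0 < n → ∀ (x : Fin n → Fin p → 𝒳) (lam : ℝ),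
      2 * gradSupNorm ν f φ x θ ≤ lam → 1.5 * lam * √(l0 θ : ℝ) / β < r →
      (∃! θhat, IsJointEstimator ν f φ x lam θhat) ∧
      ∀ θhat, IsJointEstimator ν f φ x lam θhat →
        ‖θhat - θ‖ ≤ 1.5 * lam * √(l0 θ : ℝ) / β := by
  have hθD := interior_subset hθ
  have := isProbabilityMeasure_law hθD
  have hTi : ∀ e, Integrable (pairStat φ e) (law ν f φ θ) := fun e =>
    memLp_one_iff_integrable.1 (by
      simpa using memLp_of_mem_interior_integrableExpSet
        (zero_mem_interior_integrableExpSet_pairStat hθ e) 1)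
  obtain ⟨β, hβ, hgrow⟩ := exists_quadratic_growth_log_integral_exp (measurable_pairStat hφm)
    (nondegenerate_law hθD hmin) hTi
  obtain ⟨r₀, hr₀, hball₀⟩ := Metric.nhds_basis_closedBall.mem_iff.1
    (isOpen_interior.mem_nhds hθ)
  have hball : Metric.closedBall θ (min r₀ 1) ⊆ interior (domain ν f φ) :=
    (Metric.closedBall_subset_closedBall (min_le_left _ _)).trans hball₀
  -- Radius at most `1`, the range in which quadratic growth was shown.
  refine ⟨min r₀ 1, β, lt_min hr₀ one_pos, hβ, fun n hn x lam hlam hrad => ?_⟩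
  have hL := strictConvexOn_negLogLik hφm hn x hθD hmin
  have hg := abs_partial_le_gradSupNorm hn x hθ
  have hγ : 0 ≤ gradSupNorm ν f φ x θ := Real.iSup_nonneg fun _ => abs_nonneg _
  refine l1_penalized_minimizer hL (lt_min hr₀ one_pos) hβ (hball.trans interior_subset)
    (hL.convexOn.continuousOn_interior.mono hball) _ hg (fun θ' hθ' => ?_) hlam (by linarith) hrad
  have hD' := interior_subset (hball hθ')
  have hnorm : ‖θ' - θ‖ ≤ 1 := by
    rw [← dist_eq_norm]
    exact (Metric.mem_closedBall.1 hθ').trans (min_le_right _ _)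
  refine (hgrow _ hnorm ((integrable_exp_pairing_law_iff hθD).2 hD')).trans_eq ?_
  rw [negLogLik_eq_add hn x hθD hD']
  have hlin : ∑ e, (∫ y, pairStat φ e y ∂(law ν f φ θ) - sampleStat φ x e) * (θ' e - θ e) =
      ∑ e, (θ' - θ) e * ∫ y, pairStat φ e y ∂(law ν f φ θ) -
        ∑ e, (θ' - θ) e * sampleStat φ x e := by
    rw [← Finset.sum_sub_distrib]
    exact Finset.sum_congr rfl fun e _ => by rw [PiLp.sub_apply]; ring
  rw [hlin]
  ring

/-- The probabilistic part: a uniform Chebyshev bound on the gradient at the true parameter. -/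
lemma exists_event_gradSupNorm_le [Nonempty (Pairs p)] (hφm : Measurable (Function.uncurry φ))
    {θ : Param p} (hθ : θ ∈ interior (domain ν f φ)) {Ω : Type*} [MeasurableSpace Ω]
    {P : Measure Ω} [IsProbabilityMeasure P] {n : ℕ} (hn : 0 < n) {X : Fin n → Ω → Fin p → 𝒳}
    (hX : ∀ i, HasLaw (X i) (law ν f φ θ) P) (hind : iIndepFun X P) {t : ℝ} (ht : 0 < t) :
    ∃ G : Set Ω, MeasurableSet G ∧
      ENNReal.ofReal (1 - (∑ e, Var[pairStat φ e; law ν f φ θ]) / (n * t ^ 2)) ≤ P G ∧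
      ∀ ω ∈ G, gradSupNorm ν f φ (fun i => X i ω) θ ≤ t := by
  have hθD := interior_subset hθ
  have := isProbabilityMeasure_law hθD
  have hT2 : ∀ e, MemLp (pairStat φ e) 2 (law ν f φ θ) := fun e => by
    simpa using memLp_of_mem_interior_integrableExpSet
      (zero_mem_interior_integrableExpSet_pairStat hθ e) 2
  set B : Set Ω := ⋃ e, {ω | t ≤ |∫ y, pairStat φ e y ∂(law ν f φ θ) -
    (1 / (n : ℝ)) * ∑ i, pairStat φ e (X i ω)|} with hB
  have hPB : P (toMeasurable P B) ≤
      ENNReal.ofReal ((∑ e, Var[pairStat φ e; law ν f φ θ]) / (n * t ^ 2)) := by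
    rw [measure_toMeasurable, Finset.sum_div,
      ENNReal.ofReal_sum_of_nonneg fun e _ => div_nonneg (variance_nonneg _ _) (by positivity)]
    refine (measure_iUnion_fintype_le P _).trans (Finset.sum_le_sum fun e _ => ?_)
    exact measure_abs_integral_sub_sampleMean_ge_le (measurable_pairStat hφm e) (hT2 e) hn hX
      hind ht
  -- The `X i` are only a.e. measurable, so `B` is replaced by a measurable superset of equal
  -- measure.
  refine ⟨(toMeasurable P B)ᶜ, (measurableSet_toMeasurable _ _).compl, ?_, fun ω hω => ?_⟩
  · rw [prob_compl_eq_one_sub (measurableSet_toMeasurable _ _), ENNReal.ofReal_sub _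
      (div_nonneg (Finset.sum_nonneg fun e _ => variance_nonneg _ _) (by positivity)),
      ENNReal.ofReal_one]
    exact tsub_le_tsub_left hPB 1
  · refine ciSup_le fun e => ?_
    have h : ω ∉ B := fun h => hω (subset_toMeasurable _ _ h)
    rw [lineDeriv_negLogLik hn _ hθ]
    by_contra! hlt
    exact h (Set.mem_iUnion.2 ⟨e, hlt.le⟩)

end Estimator

end SemiEFGM

theorem corollary1 {𝒳 : Type u} [MeasurableSpace 𝒳] (ν : Measure 𝒳) [SigmaFinite ν]
    (φ : 𝒳 → 𝒳 → ℝ) (hφm : Measurable (Function.uncurry φ))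
    (hφ : SemiEFGM.IsMercerKernel φ)
    (hint : ∀ c : ℝ, 0 < c → Integrable (fun x => Real.exp (-c * φ x x)) ν)
    (f : 𝒳 → ℝ) (hf : ∀ x, f x = -φ x x)
    (p : ℕ) (hp : 1 ≤ p) (θstar : SemiEFGM.Param p)
    (hmin : SemiEFGM.MinimalRepresentation ν f φ θstar)
    (hθ : ∀ e, |θstar e| ≤ 0.25)
    (hreg : (∃ s, 8 ≤ SemiEFGM.degree θstar s) → θstar ∈ interior (SemiEFGM.domain ν f φ)) :
    ∃ σ ζ r β : ℝ, 0 < σ ∧ 0 < ζ ∧ 0 < r ∧ 0 < β ∧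
      ∀ c₀ : ℝ, 2 ≤ c₀ → ∀ n : ℕ,
        max (6 * Real.log p / (σ ^ 2 * ζ ^ 2))
            (13.5 * c₀ ^ 2 * (r ^ 2)⁻¹ * (β ^ 2)⁻¹ * σ ^ 2 * SemiEFGM.l0 θstar * Real.log p)
          < (n : ℝ) →
        ∀ (Ω : Type w) [MeasurableSpace Ω] (P : Measure Ω) [IsProbabilityMeasure P]
          (X : Fin n → Ω → (Fin p → 𝒳)),
          (∀ i, HasLaw (X i) (SemiEFGM.law ν f φ θstar) P) → iIndepFun X P →
          ∃ G : Set Ω, MeasurableSet G ∧ ENNReal.ofReal (1 - 2 / (p : ℝ)) ≤ P G ∧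
            ∀ ω ∈ G, ∀ lam : ℝ,
              2 * SemiEFGM.gradSupNorm ν f φ (fun i => X i ω) θstar ≤ lam →
              lam ≤ c₀ * SemiEFGM.gradSupNorm ν f φ (fun i => X i ω) θstar →
              (∃! θhat, SemiEFGM.IsJointEstimator ν f φ (fun i => X i ω) lam θhat) ∧
              ∀ θhat, SemiEFGM.IsJointEstimator ν f φ (fun i => X i ω) lam θhat →
                ‖θhat - θstar‖ ≤
                  1.5 * c₀ * β⁻¹ * σ *
                    Real.sqrt (6 * SemiEFGM.l0 θstar * Real.log p / n) := by
  -- For `p ≤ 2` the required probability `1 - 2/p` is not positive, and the empty event works.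
  rcases le_or_gt p 2 with hp2 | hp2
  · refine ⟨1, 1, 1, 1, one_pos, one_pos, one_pos, one_pos, fun c₀ _ n _ Ω _ P _ X _ _ =>
      ⟨∅, .empty, ?_, fun ω hω => hω.elim⟩⟩
    have h : (1 : ℝ) ≤ 2 / p := by
      rw [one_le_div (by exact_mod_cast hp)]
      exact_mod_cast hp2
    rw [ENNReal.ofReal_of_nonpos (by linarith)]
    exact zero_le
  have : Nonempty (SemiEFGM.Pairs p) :=
    ⟨⟨(⟨0, by omega⟩, ⟨1, by omega⟩), by simp [Fin.lt_def]⟩⟩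
  have hint_dom : θstar ∈ interior (SemiEFGM.domain ν f φ) := by
    by_cases h : ∃ s, 8 ≤ SemiEFGM.degree θstar s
    · exact hreg h
    · exact SemiEFGM.mem_interior_domain hφm hφ hint hf hθ fun s =>
        not_le.1 fun hs => h ⟨s, hs⟩
  have := SemiEFGM.neZero_pi_of_minimalRepresentation hmin
  obtain ⟨r, β, hr, hβ, hdet⟩ :=
    SemiEFGM.exists_error_bound_jointEstimator hφm hint_dom hmin
  set V := ∑ e, Var[SemiEFGM.pairStat φ e; SemiEFGM.law ν f φ θstar] with hV
  have hV0 : 0 ≤ V := Finset.sum_nonneg fun e _ => variance_nonneg _ _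
  have hp0 : (0 : ℝ) < p := by positivity
  have hlog : 1 ≤ Real.log p := by
    rw [Real.le_log_iff_exp_le hp0]
    have : (3 : ℝ) ≤ p := by exact_mod_cast hp2
    linarith [Real.exp_one_lt_d9]
  -- With `σ² = p (V + 1)` the union bound `V / (6 σ² log p)` is at most `2/p`, since `log p ≥ 1`;
  -- the `+ 1` keeps `σ` positive. With `ζ = 1` the first bound on `n` serves to give `n > 0`.
  refine ⟨√(p * (V + 1)), 1, r, β, by positivity, one_pos, hr, hβ,
    fun c₀ hc₀ n hn Ω _ P _ X hX hind => ?_⟩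
  set σ := √(p * (V + 1)) with hσdef
  have hσ : 0 < σ := by positivity
  have hσ2 : σ ^ 2 = p * (V + 1) := Real.sq_sqrt (by positivity)
  obtain ⟨hn1, hn2⟩ := max_lt_iff.1 hn
  have hn0 : (0 : ℝ) < n := lt_of_le_of_lt (by positivity) hn1
  have hnpos : 0 < n := by exact_mod_cast hn0
  set t := σ * √(6 * Real.log p / n) with ht
  have ht0 : 0 < t := by positivity
  have ht2 : n * t ^ 2 = 6 * Real.log p * σ ^ 2 := by
    have hq : 0 ≤ 6 * Real.log p / n := by positivity
    rw [ht, mul_pow, Real.sq_sqrt hq, mul_left_comm, mul_div_cancel₀ _ hn0.ne', mul_comm]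
  obtain ⟨G, hG, hPG, hGt⟩ :=
    SemiEFGM.exists_event_gradSupNorm_le hφm hint_dom hnpos hX hind ht0
  refine ⟨G, hG, le_trans (ENNReal.ofReal_le_ofReal (sub_le_sub_left ?_ 1)) hPG,
    fun ω hω lam hl1 hl2 => ?_⟩
  · rw [ht2, hσ2, div_le_div_iff₀ (by positivity) hp0]
    have h1 : (p : ℝ) * (V + 1) ≤ Real.log p * (p * (V + 1)) :=
      le_mul_of_one_le_left (by positivity) hlog
    nlinarith
  have hlam : lam ≤ c₀ * t := hl2.trans (by gcongr; exact hGt ω hω)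
  have hbound : 1.5 * lam * √(SemiEFGM.l0 θstar : ℝ) / β ≤
      1.5 * c₀ * β⁻¹ * σ * √(6 * SemiEFGM.l0 θstar * Real.log p / n) := by
    have hs : √(6 * SemiEFGM.l0 θstar * Real.log p / n) =
        √(6 * Real.log p / n) * √(SemiEFGM.l0 θstar : ℝ) := by
      rw [← Real.sqrt_mul (by positivity)]
      congr 1
      ring
    calc 1.5 * lam * √(SemiEFGM.l0 θstar : ℝ) / β
        ≤ 1.5 * (c₀ * t) * √(SemiEFGM.l0 θstar : ℝ) / β := by gcongr
      _ = _ := by rw [hs, ht]; ring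
  -- Squaring gives the second bound on `n`: `1.5² * 6 = 13.5`.
  have hrad : 1.5 * c₀ * β⁻¹ * σ * √(6 * SemiEFGM.l0 θstar * Real.log p / n) < r := by
    refine lt_of_pow_lt_pow_left₀ 2 hr.le ?_
    rw [mul_pow, Real.sq_sqrt (by positivity)]
    have h := mul_lt_mul_of_pos_right hn2 (by positivity : 0 < r ^ 2 / n)
    calc _ = 13.5 * c₀ ^ 2 * (r ^ 2)⁻¹ * (β ^ 2)⁻¹ * σ ^ 2 * SemiEFGM.l0 θstar * Real.log p *
          (r ^ 2 / n) := by field_simp; norm_num; ring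
      _ < n * (r ^ 2 / n) := h
      _ = r ^ 2 := by field_simp
  obtain ⟨hex, hle⟩ := hdet n hnpos (fun i => X i ω) lam hl1 (hbound.trans_lt hrad)
  exact ⟨hex, fun θhat h => (hle θhat h).trans hbound⟩
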